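/- A (one-round) $k$-server private information retrieval scheme for databases of $n$ bits consists of a user and $k$ databases that do not communicate with each other and all hold the same $x=(x_1,\dots,x_n)\in\{0,1\}^n$. On input $i\in\{1,\dots,n\}$ the user draws randomness and sends a bit string to each database; each database replies with a bit string that depends only on $x$ and on the string it received; and from $i$, the randomness and the replies the user outputs one bit. It is required that, for all $x$ and $i$, the output is $x_i$ with probability $1$, and that, for each $j\in\{1,\dots,k\}$, the distribution of the string sent to the $j$-th database does not depend on $i$. The length of each message depends only on the database concerned and on whether it is sent or received by it, and the communication complexity $C_k(n)$ is the total number of bits exchanged between the user and the $k$ databases. **Theorem.** For every integer $r>1$ there are an integer $k\le 3\cdot 2^{r-2}$ and a constant $c>0$ (both depending only on $r$) such that for every integer $n>1$ there is a $k$-server private information retrieval scheme for databases of $n$ bits, whose communication complexity satisfies, whenever $n\ge 3$, $$C_k(n)\le n^{\,c\,\left(\log\log n/\log n\right)^{(r-1)/r}},$$ that is, $C_k(n)=n^{O\left((\log\log n/\log n)^{(r-1)/r}\right)}$. Here $\log$ is the natural logarithm. -/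

import Mathlib

/-- A one-round protocol between a user and `k` non-communicating databases, each holding the
same string `x` of `n` bits. The user, who wants the bit with index `i`, draws a random `ρ`
from `coins`, sends the bit string `query i ρ j` to the `j`-th database, receives from it a bit
string that depends only on `x` and on the received query, and computes one bit from `i`, `ρ`
and all the answers. The message lengths depend only on the database, not on `i`, `x` or `ρ`. -/
structure PIRProtocol (k n : ℕ) where
  /-- the number of bits sent by the user to each database -/
  queryLen : Fin k → ℕ
  /-- the number of bits sent by each database to the user -/
  answerLen : Fin k → ℕ
  /-- the sample space of the user's randomness -/
  Rand : Type
  /-- the law of the user's randomness -/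
  coins : PMF Rand
  /-- the user's messages -/
  query : Fin n → Rand → (j : Fin k) → (Fin (queryLen j) → Bool)
  /-- the databases' messages -/
  answer : (j : Fin k) → (Fin n → Bool) → (Fin (queryLen j) → Bool) → (Fin (answerLen j) → Bool)
  /-- the user's output -/
  decode : Fin n → Rand → ((j : Fin k) → (Fin (answerLen j) → Bool)) → Bool

namespace PIRProtocol

variable {k n : ℕ} (P : PIRProtocol k n)

/-- What the user outputs on index `i` and randomness `ρ` when the data are `x`. -/
def output (x : Fin n → Bool) (i : Fin n) (ρ : P.Rand) : Bool :=
  P.decode i ρ (fun j => P.answer j x (P.query i ρ j))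

/-- For all data and all indices the output equals the requested bit with probability one. -/
def IsCorrect : Prop :=
  ∀ (x : Fin n → Bool) (i : Fin n), P.coins.map (P.output x i) = PMF.pure (x i)

/-- Perfect (information-theoretic) privacy: for each single database, the distribution of the
query that it receives is the same for all requested indices. -/
def IsPrivate : Prop :=
  ∀ (j : Fin k) (i i' : Fin n),
    P.coins.map (fun ρ => P.query i ρ j) = P.coins.map (fun ρ => P.query i' ρ j)

/-- The communication complexity: the total number of bits exchanged between the user and
the `k` databases. -/
def communication : ℕ := ∑ j, (P.queryLen j + P.answerLen j)

end PIRProtocol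

/-- A `k`-server private information retrieval scheme for databases of `n` bits. -/
structure PIRScheme (k n : ℕ) extends PIRProtocol k n where
  correct : toPIRProtocol.IsCorrect
  privacy : toPIRProtocol.IsPrivate

/-! This is the matching-vector construction of Efremenko, built on Grolmusz's set systems. Each
index `a` gets a character `f a` of a finite group `V`; a server holding `v` returns `∑ a, x a * f a
v`. The user sends `ρ` plus shifts, and a fixed linear combination of the answers kills all `f a`
with `a ≠ i`. The characters come from sets of size `W - 1`, where `W = ∏ p i ^ e i`. By Lucas, `p i
^ e i ∣ |A ∩ B| + 1` is read off a binomial coefficient mod `p i`, which is an inner product of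
incidence vectors. All these divisibilities hold together only if `A = B`, so the exponents at roots
of unity are 0-1 vectors, zero exactly on the diagonal. Isolating zero costs two terms per prime,
but only three for the pair 3, 11 in characteristic 67; hence `3 * 2 ^ (r - 2)` servers. -/

/-! ### Schemes from characters -/

theorem PMF.map_add_right_uniformOfFintype {V : Type*} [AddGroup V] [Fintype V] (s : V) :
    (PMF.uniformOfFintype V).map (fun v => v + s) = PMF.uniformOfFintype V := by
  classical
  ext v
  rw [PMF.map_apply, tsum_eq_single (v - s)]
  · simp
  · intro w hw
    rw [if_neg]
    rintro rfl
    simp at hw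

/-- A family of additive characters of a finite group `V`, together with shifts and coefficients
that isolate each of them, gives a private information retrieval scheme. -/
theorem exists_pirScheme {V F : Type} [AddCommGroup V] [Fintype V] [Field F] [Fintype F]
    {n k : ℕ} (f : Fin n → AddChar V F) (c : Fin k → F) (shift : Fin k → Fin n → V)
    (h : ∀ a b, ∑ j, c j * f a (shift j b) = if a = b then 1 else 0)
    {Q A : ℕ} (hQ : Fintype.card V ≤ 2 ^ Q) (hA : Fintype.card F ≤ 2 ^ A) :
    ∃ P : PIRScheme k n, P.communication = k * (Q + A) := by
  classical
  obtain ⟨encV⟩ : Nonempty (V ↪ (Fin Q → Bool)) :=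
    Function.Embedding.nonempty_of_card_le (by simpa using hQ)
  obtain ⟨encF⟩ : Nonempty (F ↪ (Fin A → Bool)) :=
    Function.Embedding.nonempty_of_card_le (by simpa using hA)
  let decV := Function.invFun encV
  let decF := Function.invFun encF
  have hV (v) : decV (encV v) = v := Function.leftInverse_invFun encV.injective v
  have hF (v) : decF (encF v) = v := Function.leftInverse_invFun encF.injective v
  refine ⟨⟨⟨fun _ => Q, fun _ => A, V, PMF.uniformOfFintype V,
    fun i ρ j => encV (ρ + shift j i),
    fun _ x q => encF (∑ a, (if x a then 1 else 0) * f a (decV q)),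
    fun _ _ ans => decide (∑ j, c j * decF (ans j) ≠ 0)⟩, ?_, ?_⟩, ?_⟩
  · intro x i
    rw [← PMF.map_const]
    congr 1
    funext ρ
    simp only [PIRProtocol.output, hV, hF, Function.const_apply]
    -- Multiplicativity pulls out `f a ρ`, and `h` leaves only `a = i`. Since `f i ρ` is a unit,
    -- testing for nonzero recovers the bit.
    have key : ∑ j, c j * ∑ a, (if x a then (1 : F) else 0) * f a (ρ + shift j i)
        = (if x i then 1 else 0) * f i ρ := by
      simp_rw [Finset.mul_sum, AddChar.map_add_eq_mul]
      rw [Finset.sum_comm]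
      have (a : Fin n) : ∑ j, c j * ((if x a then (1 : F) else 0) * (f a ρ * f a (shift j i)))
          = (if x a then 1 else 0) * f a ρ * (if a = i then 1 else 0) := by
        rw [← h, Finset.mul_sum]
        exact Finset.sum_congr rfl fun j _ => by ring
      rw [Finset.sum_congr rfl fun a _ => this a]
      simp
    simp only [key]
    have hne : f i ρ ≠ 0 := ((f i).val_isUnit ρ).ne_zero
    cases x i <;> simp [hne]
  · intro j i i'
    have (i : Fin n) : (fun ρ => encV (ρ + shift j i)) = encV ∘ fun ρ => ρ + shift j i := rfl
    simp only [this, ← PMF.map_comp, PMF.map_add_right_uniformOfFintype]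
  · simp [PIRProtocol.communication]

/-- All `e` base-`p` digits of `p ^ e - 1` are `p - 1`, so by Lucas the binomial survives only if
the last `e` digits of `t` are `p - 1` too. The induction peels off the last digit. -/
theorem ZMod.natCast_choose_pow_sub_one (p : ℕ) [hp : Fact p.Prime] (e t : ℕ) :
    ((t.choose (p ^ e - 1) : ℕ) : ZMod p) = if p ^ e ∣ t + 1 then 1 else 0 := by
  have hp1 : 1 < p := hp.out.one_lt
  induction e generalizing t with
  | zero => simp
  | succ e ih =>
    have hpos : 0 < p ^ e := by positivity
    have hd : p ^ (e + 1) - 1 = p * (p ^ e - 1) + (p - 1) := by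
      rw [pow_succ', Nat.mul_sub, mul_one]
      have : p ≤ p * p ^ e := Nat.le_mul_of_pos_right _ hpos
      omega
    have hmod : (p ^ (e + 1) - 1) % p = p - 1 := by
      rw [hd, Nat.mul_add_mod, Nat.mod_eq_of_lt (by omega)]
    have hdiv : (p ^ (e + 1) - 1) / p = p ^ e - 1 := by
      rw [hd, Nat.mul_add_div (by omega), Nat.div_eq_of_lt (by omega), add_zero]
    have h1 := (ZMod.natCast_eq_natCast_iff _ _ p).2
      (Choose.choose_modEq_choose_mod_mul_choose_div_nat (p := p) (n := t) (k := p ^ (e + 1) - 1))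
    rw [h1, hmod, hdiv, Nat.cast_mul, ih]
    have hlt : t % p < p := Nat.mod_lt _ (by omega)
    have ht := Nat.div_add_mod t p
    by_cases hc : t % p = p - 1
    · have : t + 1 = p * (t / p + 1) := by rw [mul_add]; omega
      have hiff : p ^ (e + 1) ∣ t + 1 ↔ p ^ e ∣ t / p + 1 := by
        rw [this, pow_succ']
        exact Nat.mul_dvd_mul_iff_left (by omega)
      simp [hc, hiff]
    · rw [Nat.choose_eq_zero_of_lt (by omega : t % p < p - 1), Nat.cast_zero, zero_mul, if_neg]
      · intro hdvd
        have hpd : p ∣ t + 1 := (dvd_pow_self p (by omega)).trans hdvd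
        rw [show t + 1 = p * (t / p) + (t % p + 1) by omega,
          Nat.dvd_add_right (dvd_mul_right _ _)] at hpd
        have := Nat.le_of_dvd (by omega) hpd
        omega

/-! ### Roots of unity and decoding coefficients -/

/-- The trinomial `58 + 57 x y³ + 20 x² y` over a field of characteristic `67` vanishes at
`(37, 64)`, `(37, 1)` and `(1, 64)` and equals `1` at `(1, 1)`; here `37` and `64` have
multiplicative orders `3` and `11`. Every further root of unity costs a factor of two. -/
theorem exists_decoding_coefficients {F : Type*} [Field F] [CharP F 67] {s : ℕ}
    (γ : Fin (s + 2) → F) (h0 : γ 0 = 37) (h1 : γ 1 = 64) (hne : ∀ i, γ i ≠ 1) :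
    ∃ (c : Fin (3 * 2 ^ s) → F) (l : Fin (3 * 2 ^ s) → Fin (s + 2) → ℕ),
      ∀ t : Fin (s + 2) → ℕ, (∀ i, t i ≤ 1) →
        ∑ j, c j * ∏ i, γ i ^ (l j i * t i) = if t = 0 then 1 else 0 := by
  have h67 : (67 : F) = 0 := by exact_mod_cast CharP.cast_eq_zero F 67
  let κ := Fin 3 × (Fin s → Bool)
  have hcard : Fintype.card κ = 3 * 2 ^ s := by simp [κ]
  let eqv : Fin (3 * 2 ^ s) ≃ κ := (Fintype.equivFinOfCardEq hcard).symm
  let c0 : Fin 3 → F := ![58, 57, 20]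
  let l0 : Fin 3 → ℕ := ![0, 1, 2]
  let l1 : Fin 3 → ℕ := ![0, 3, 1]
  let g : Fin s → F := fun i => γ i.succ.succ
  have hg (i : Fin s) : 1 - g i ≠ 0 := sub_ne_zero.2 (hne _).symm
  -- Coefficients of `(z - g) / (1 - g)`, which is 1 at `z = 1` and 0 at `z = g`.
  let d : Fin s → Bool → F := fun i b => if b then 1 / (1 - g i) else - g i / (1 - g i)
  refine ⟨fun j => c0 (eqv j).1 * ∏ i, d i ((eqv j).2 i),
    fun j => Fin.cons (l0 (eqv j).1) (Fin.cons (l1 (eqv j).1) fun i => ((eqv j).2 i).toNat), ?_⟩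
  intro t ht
  rw [eqv.sum_comp (fun q : κ => c0 q.1 * (∏ i, d i (q.2 i)) *
    ∏ i, γ i ^ ((Fin.cons (l0 q.1) (Fin.cons (l1 q.1) fun i => (q.2 i).toNat) :
      Fin (s + 2) → ℕ) i * t i)), Fintype.sum_prod_type]
  have hfac (i : Fin s) : ∑ b : Bool, d i b * g i ^ (b.toNat * t i.succ.succ)
      = if t i.succ.succ = 0 then 1 else 0 := by
    have := ht i.succ.succ
    have := hg i
    interval_cases t i.succ.succ <;> simp [d] <;> field_simp <;> ring
  have hmain : ∑ a : Fin 3, c0 a * (37 ^ (l0 a * t 0) * 64 ^ (l1 a * t 1))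
      = if t 0 = 0 ∧ t 1 = 0 then 1 else 0 := by
    have := ht 0
    have := ht 1
    interval_cases t 0 <;> interval_cases t 1 <;> simp [Fin.sum_univ_three, c0, l0, l1]
    · linear_combination 2 * h67
    · linear_combination ((58 + 57 * 64 ^ 3 + 20 * 64) / 67 : ℕ) * h67
    · linear_combination ((58 + 57 * 37 + 20 * 37 ^ 2) / 67 : ℕ) * h67
    · linear_combination ((58 + 57 * (37 * 64 ^ 3) + 20 * (37 ^ 2 * 64)) / 67 : ℕ) * h67
  have hsplit : ∑ a : Fin 3, ∑ b : Fin s → Bool, c0 a * (∏ i, d i (b i)) *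
      ∏ i, γ i ^ ((Fin.cons (l0 a) (Fin.cons (l1 a) fun i => (b i).toNat) :
        Fin (s + 2) → ℕ) i * t i)
      = (∑ a : Fin 3, c0 a * (37 ^ (l0 a * t 0) * 64 ^ (l1 a * t 1))) *
        ∏ i : Fin s, ∑ b : Bool, d i b * g i ^ (b.toNat * t i.succ.succ) := by
    rw [Finset.prod_univ_sum, Fintype.piFinset_univ, Finset.sum_mul_sum]
    refine Finset.sum_congr rfl fun a _ => Finset.sum_congr rfl fun b _ => ?_
    rw [Fin.prod_univ_succ, Fin.prod_univ_succ, Finset.prod_mul_distrib]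
    have h1' : γ (Fin.succ 0) = 64 := h1
    simp only [Fin.cons_zero, Fin.cons_succ, h0, h1', g]
    rw [show t (Fin.succ 0) = t 1 from rfl]
    ring
  rw [hsplit, hmain, Finset.prod_congr rfl fun i _ => hfac i, Finset.prod_ite_zero]
  have hiff : t = 0 ↔ (t 0 = 0 ∧ t 1 = 0) ∧ ∀ i : Fin s, t i.succ.succ = 0 := by
    rw [funext_iff, Fin.forall_fin_succ, Fin.forall_fin_succ, and_assoc]
    rfl
  rw [if_congr hiff rfl rfl]
  by_cases h : t 0 = 0 ∧ t 1 = 0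
  · simp [h]
  · rw [if_neg h, zero_mul, if_neg fun h' => h h'.1]

/-- A finite field of characteristic `67` that contains nontrivial roots of unity of the given
orders, with prescribed roots for the first two. -/
theorem exists_field_roots {s : ℕ} (p : Fin (s + 2) → ℕ) (hp : ∀ i, (p i).Prime)
    (h67 : ∀ i, p i ≠ 67) (h0 : p 0 = 3) (h1 : p 1 = 11) :
    ∃ (F : Type) (_ : Field F) (_ : Fintype F) (_ : CharP F 67) (γ : Fin (s + 2) → F),
      γ 0 = 37 ∧ γ 1 = 64 ∧ (∀ i, γ i ≠ 1) ∧ ∀ i, γ i ^ p i = 1 := by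
  classical
  have : Fact (Nat.Prime 67) := ⟨by norm_num⟩
  -- As `p i - 1 ∣ t`, Fermat gives `p i ∣ 67 ^ t - 1`, and Cauchy then gives an element of order `p
  -- i`.
  let t := ∏ i, (p i - 1)
  have ht : t ≠ 0 := Finset.prod_ne_zero_iff.2 fun i _ => by have := (hp i).one_lt; omega
  let F := GaloisField 67 t
  let _ : Fintype F := Fintype.ofFinite F
  have hcard : Fintype.card F = 67 ^ t := by
    rw [← Nat.card_eq_fintype_card, GaloisField.card 67 t ht]
  have hroot (i) : ∃ g : F, g ≠ 1 ∧ g ^ p i = 1 := by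
    have : Fact (p i).Prime := ⟨hp i⟩
    have hdvd : p i ∣ Fintype.card Fˣ := by
      rw [Fintype.card_units, hcard]
      refine (Nat.modEq_iff_dvd' (Nat.one_le_pow _ _ (by norm_num))).1 (Nat.ModEq.symm ?_)
      have hco : Nat.Coprime 67 (p i) := (Nat.coprime_primes (by norm_num) (hp i)).2 (h67 i).symm
      have h := Nat.ModEq.pow_totient hco
      rw [Nat.totient_prime (hp i)] at h
      obtain ⟨u, hu⟩ : p i - 1 ∣ t := Finset.dvd_prod_of_mem (fun i => p i - 1) (Finset.mem_univ i)
      rw [hu, pow_mul]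
      simpa using h.pow u
    obtain ⟨g, hg⟩ := exists_prime_orderOf_dvd_card (p i) hdvd
    refine ⟨g, fun h => ?_, ?_⟩
    · rw [Units.val_eq_one] at h
      rw [h, orderOf_one] at hg
      exact (hp i).one_lt.ne hg
    · rw [← Units.val_pow_eq_pow_val, ← hg, pow_orderOf_eq_one, Units.val_one]
  choose g hg1 hg2 using hroot
  have hz : (67 : F) = 0 := by exact_mod_cast CharP.cast_eq_zero F 67
  have hne (m : ℕ) (h : ¬ 67 ∣ m) : (m : F) ≠ 0 := by rwa [Ne, CharP.cast_eq_zero_iff F 67]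
  refine ⟨F, inferInstance, inferInstance, inferInstance,
    Fin.cons 37 (Fin.cons 64 fun i => g i.succ.succ), rfl, rfl, ?_, ?_⟩
  · refine Fin.forall_fin_succ.2 ⟨fun h => hne 36 (by norm_num) ?_,
      Fin.forall_fin_succ.2 ⟨fun h => hne 63 (by norm_num) ?_, fun i => hg1 _⟩⟩
    · simp only [Fin.cons_zero] at h
      push_cast
      linear_combination h
    · simp only [Fin.cons_succ, Fin.cons_zero] at h
      push_cast
      linear_combination h
  · refine Fin.forall_fin_succ.2 ⟨?_, Fin.forall_fin_succ.2 ⟨?_, fun i => hg2 _⟩⟩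
    · rw [h0, Fin.cons_zero]
      linear_combination ((37 ^ 3 - 1) / 67 : ℕ) * hz
    · rw [Fin.succ_zero_eq_one, h1]
      change (64 : F) ^ 11 = 1
      linear_combination ((64 ^ 11 - 1) / 67 : ℕ) * hz

/-! ### Matching vectors from sets -/

theorem Finset.sum_powersetCard_subset_and_subset {α R : Type*} [Fintype α] [DecidableEq α]
    [AddCommMonoidWithOne R] (A B : Finset α) (d : ℕ) :
    ∑ C : powersetCard d (univ : Finset α),
      (if C.1 ⊆ A then if C.1 ⊆ B then (1 : R) else 0 else 0) = ((A ∩ B).card.choose d : ℕ) := by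
  rw [Finset.sum_coe_sort (powersetCard d (univ : Finset α))
    fun C => if C ⊆ A then if C ⊆ B then (1 : R) else 0 else 0, ← card_powersetCard]
  simp_rw [← ite_and]
  rw [Finset.sum_boole]
  congr 2
  ext C
  simp only [mem_filter, mem_powersetCard, subset_inter_iff, subset_univ, true_and]
  tauto

/-- Sets of the same size `∏ p i ^ e i - 1` give matching vectors modulo the primes `p i`:
the inner products are governed by `(A ∩ B).card.choose (p i ^ e i - 1)`. -/
theorem exists_pirScheme_of_sets {ι α F : Type} [Fintype ι] [DecidableEq ι] [Fintype α]
    [DecidableEq α] [Field F] [Fintype F] (p e : ι → ℕ) (hp : ∀ i, (p i).Prime)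
    (hinj : Function.Injective p) (γ : ι → F) (hγ : ∀ i, γ i ^ p i = 1) {k : ℕ} (c : Fin k → F)
    (l : Fin k → ι → ℕ)
    (hc : ∀ t : ι → ℕ, (∀ i, t i ≤ 1) →
      ∑ j, c j * ∏ i, γ i ^ (l j i * t i) = if t = 0 then 1 else 0)
    {n : ℕ} (S : Fin n → Finset α) (hS : Function.Injective S)
    (hcard : ∀ a, (S a).card + 1 = ∏ i, p i ^ e i)
    {A : ℕ} (hA : Fintype.card F ≤ 2 ^ A) :
    ∃ P : PIRScheme k n, P.communication =
      k * (∑ i, p i * ((Fintype.card α).choose (p i ^ e i - 1) + 1) + A) := by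
  have hfact (i) : Fact (p i).Prime := ⟨hp i⟩
  let T (i : ι) := Finset.powersetCard (p i ^ e i - 1) (Finset.univ : Finset α)
  let V := ∀ i, Option (T i) → ZMod (p i)
  let L (A : Finset α) (v : V) (i : ι) : ZMod (p i) :=
    v i none + ∑ C : T i, if C.1 ⊆ A then v i (some C) else 0
  have hV0 (i o) : (0 : V) i o = 0 := rfl
  have hVadd (v w : V) (i o) : (v + w) i o = v i o + w i o := rfl
  have hL0 (A i) : L A 0 i = 0 := by simp [L, hV0]
  have hLadd (A v w i) : L A (v + w) i = L A v i + L A w i := by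
    simp only [L, hVadd]
    rw [add_add_add_comm, ← Finset.sum_add_distrib]
    congr 1
    exact Finset.sum_congr rfl fun C _ => by split_ifs <;> simp
  let f (a : Fin n) : AddChar V F :=
    { toFun := fun v => ∏ i, AddChar.zmodChar (p i) (hγ i) (L (S a) v i)
      map_zero_eq_one' := by simp [hL0]
      map_add_eq_mul' := fun v w => by
        simp only [hLadd, AddChar.map_add_eq_mul, Finset.prod_mul_distrib] }
  -- The coordinate `none` carries the constant term: pairing with `S a` gives `l j i * (1 -
  -- choose)`.
  let shift (j : Fin k) (b : Fin n) : V := fun i o =>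
    l j i * o.elim 1 fun C => if C.1 ⊆ S b then -1 else 0
  have hLshift (j a b i) : L (S a) (shift j b) i =
      ((l j i * if p i ^ e i ∣ (S a ∩ S b).card + 1 then 0 else 1 : ℕ) : ZMod (p i)) := by
    have h1 := ZMod.natCast_choose_pow_sub_one (p i) (e i) (S a ∩ S b).card
    rw [← Finset.sum_powersetCard_subset_and_subset] at h1
    have h2 : L (S a) (shift j b) i = l j i * (1 - ∑ C : T i,
        if C.1 ⊆ S a then if C.1 ⊆ S b then (1 : ZMod (p i)) else 0 else 0) := by
      simp only [L, shift, Option.elim]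
      rw [mul_sub, sub_eq_add_neg, Finset.mul_sum, ← Finset.sum_neg_distrib]
      congr 1
      exact Finset.sum_congr rfl fun C _ => by split_ifs <;> simp
    rw [h2, h1]
    split_ifs <;> simp
  have hkey (a b) : ∑ j, c j * f a (shift j b) = if a = b then 1 else 0 := by
    let t (i : ι) : ℕ := if p i ^ e i ∣ (S a ∩ S b).card + 1 then 0 else 1
    have ht : t = 0 ↔ a = b := by
      have h1 : t = 0 ↔ ∏ i, p i ^ e i ∣ (S a ∩ S b).card + 1 := by
        constructor
        · intro h
          refine Finset.prod_dvd_of_isRelPrime (fun i _ j _ hij => ?_) fun i _ => ?_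
          · exact Nat.coprime_iff_isRelPrime.1 (Nat.Coprime.pow _ _
              ((Nat.coprime_primes (hp i) (hp j)).2 (hinj.ne hij)))
          · have := congrFun h i
            simpa [t] using this
        · intro h
          funext i
          have := (Finset.dvd_prod_of_mem (fun i => p i ^ e i) (Finset.mem_univ i)).trans h
          simpa [t] using this
      rw [h1, ← hcard a]
      constructor
      · intro h
        -- `|S a ∩ S b| + 1` is at most `W`, so divisibility by `W` forces equality.
        have hle := Nat.le_of_dvd (Nat.succ_pos _) h
        have hsub : S a ∩ S b = S a := Finset.eq_of_subset_of_card_le Finset.inter_subset_left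
          (by omega)
        have hsub2 : S a ⊆ S b := Finset.inter_eq_left.1 hsub
        have := hcard a
        have := hcard b
        exact hS (Finset.eq_of_subset_of_card_le hsub2 (by omega))
      · rintro rfl
        simp
    have h := hc t fun i => by simp only [t]; split_ifs <;> simp
    rw [if_congr ht.symm rfl rfl, ← h]
    refine Finset.sum_congr rfl fun j _ => ?_
    congr 1
    refine Finset.prod_congr rfl fun i _ => ?_
    rw [hLshift, AddChar.zmodChar_apply']
  refine exists_pirScheme f c shift hkey ?_ hA
  rw [← Finset.prod_pow_eq_pow_sum, Fintype.card_pi]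
  refine Finset.prod_le_prod' fun i _ => ?_
  have hT : Fintype.card (T i) = (Fintype.card α).choose (p i ^ e i - 1) := by
    simp [T]
  rw [Fintype.card_fun, ZMod.card, Fintype.card_option, hT, pow_mul]
  exact Nat.pow_le_pow_left Nat.lt_two_pow_self.le _

/-! ### Choice of parameters -/

/-- The sets are graphs of distinct functions `Fin w → Fin b`. -/
theorem exists_sets {n w b : ℕ} (h : n ≤ b ^ w) :
    ∃ S : Fin n → Finset (Fin w × Fin b), Function.Injective S ∧ ∀ a, (S a).card = w := by
  obtain ⟨g⟩ : Nonempty (Fin n ↪ (Fin w → Fin b)) :=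
    Function.Embedding.nonempty_of_card_le (by simpa using h)
  have hinj (a : Fin n) : Function.Injective fun j => (j, g a j) :=
    fun i j h => (Prod.ext_iff.1 h).1
  refine ⟨fun a => Finset.univ.map ⟨_, hinj a⟩, fun a a' h => g.injective (funext fun j => ?_),
    fun a => by simp⟩
  have hj : (j, g a j) ∈ Finset.univ.map ⟨_, hinj a⟩ :=
    Finset.mem_map_of_mem ⟨_, hinj a⟩ (Finset.mem_univ j)
  rw [show Finset.univ.map ⟨_, hinj a⟩ = Finset.univ.map ⟨_, hinj a'⟩ from h] at hj
  obtain ⟨i, -, hi⟩ := Finset.mem_map.1 hj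
  obtain ⟨h1, h2⟩ := Prod.ext_iff.1 hi
  simp only [Function.Embedding.coeFn_mk] at h1 h2
  rw [← h2, h1]

theorem exists_prime_power_parameters {r : ℕ} (hr : 0 < r) (p : Fin r → ℕ) (hp : ∀ i, 1 < p i)
    (k A : ℕ) :
    ∃ c : ℝ, 0 < c ∧ ∀ n : ℕ, 3 ≤ n → ∃ (e : Fin r → ℕ) (b : ℕ),
      n ≤ b ^ (∏ i, p i ^ e i - 1) ∧
      ((k * (∑ i, p i * (((∏ i, p i ^ e i - 1) * b).choose (p i ^ e i - 1) + 1) + A) : ℕ) : ℝ) ≤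
        (n : ℝ) ^ (c * (Real.log (Real.log n) / Real.log n) ^ (((r : ℝ) - 1) / r)) := by
  have hr0 : (r : ℝ) ≠ 0 := by positivity
  have hlog3 : 1 < Real.log 3 := by
    rw [Real.lt_log_iff_exp_lt (by norm_num)]
    exact Real.exp_one_lt_d9.trans (by norm_num)
  -- Positive lower bound for `log log n`: dividing by `δ` absorbs constants into multiples of it.
  set δ := Real.log (Real.log 3) with hδ
  have hδ0 : 0 < δ := Real.log_pos hlog3
  set M : ℝ := ∏ i, (p i : ℝ) with hM
  have hp1 (i) : (1 : ℝ) ≤ p i := by exact_mod_cast (hp i).le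
  have hM1 : 1 ≤ M := by
    rw [hM]
    exact_mod_cast Finset.one_le_prod' fun i _ => (hp i).le
  have hpM (i) : (p i : ℝ) ≤ M := by
    have : p i ≤ ∏ i, p i := Nat.le_of_dvd
      (Finset.prod_pos fun i _ => (Nat.zero_lt_one.trans (hp i)))
      (Finset.dvd_prod_of_mem p (Finset.mem_univ i))
    rw [hM]
    exact_mod_cast this
  set C₁ : ℝ := 4 * M / δ + 1 with hC₁
  have hC₁1 : 1 ≤ C₁ := by
    have : 0 ≤ 4 * M / δ := by positivity
    rw [hC₁]; linarith
  set C₂ : ℝ := Real.log C₁ / δ + 2 with hC₂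
  have hC₂0 : 0 < C₂ := by
    have : 0 ≤ Real.log C₁ / δ := div_nonneg (Real.log_nonneg hC₁1) hδ0.le
    rw [hC₂]; linarith
  set K : ℝ := k * (2 * ∑ i, (p i : ℝ) + A) + 1 with hK
  have hK1 : 1 ≤ K := by
    have : 0 ≤ (k : ℝ) * (2 * ∑ i, (p i : ℝ) + A) := by positivity
    rw [hK]; linarith
  set C₃ : ℝ := M * C₂ + Real.log K / δ with hC₃
  have hC₃0 : 0 < C₃ := by
    have : 0 ≤ Real.log K / δ := div_nonneg (Real.log_nonneg hK1) hδ0.le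
    have : 0 < M * C₂ := by positivity
    rw [hC₃]; linarith
  refine ⟨C₃ * 2 ^ (1 / r : ℝ), by positivity, fun n hn => ?_⟩
  have hn0 : (0 : ℝ) < n := by positivity
  set L := Real.log n with hL
  have hL3 : Real.log 3 ≤ L := Real.log_le_log (by norm_num) (by exact_mod_cast hn)
  have hL1 : 1 < L := hlog3.trans_le hL3
  set l := Real.log L with hl
  have hδl : δ ≤ l := Real.log_le_log (by linarith) hL3
  have hl0 : 0 < l := hδ0.trans_le hδl
  have hlL : l ≤ L := (Real.log_le_sub_one_of_pos (by linarith)).trans (by linarith)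
  -- `W` will be of order `X`, each prime power of order `X ^ (1 / r)`. The factor 2 gives `W - 1 ≥
  -- X / 2`, hence `L ^ (W - 1) ≥ n`.
  set X := 2 * L / l with hX
  have hX2 : 2 ≤ X := by rw [hX, le_div_iff₀ hl0]; linarith
  set y := X ^ (1 / r : ℝ) with hy
  have hy1 : 1 ≤ y := Real.one_le_rpow (by linarith) (by positivity)
  have hyr : y ^ r = X := by
    rw [hy, ← Real.rpow_natCast, ← Real.rpow_mul (by linarith), one_div_mul_cancel hr0,
      Real.rpow_one]
  have he (i) : ∃ e : ℕ, y ≤ (p i : ℝ) ^ e ∧ (p i : ℝ) ^ e ≤ p i * y := by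
    obtain ⟨m, h1, h2⟩ := exists_nat_pow_near hy1 (by exact_mod_cast hp i : (1 : ℝ) < p i)
    refine ⟨m + 1, h2.le, ?_⟩
    rw [pow_succ']
    gcongr
  choose e he1 he2 using he
  set W := ∏ i, p i ^ e i with hW
  have hWpos : 1 ≤ W := Finset.one_le_prod' fun i _ => Nat.one_le_pow _ _ (by have := hp i; omega)
  have hWX : X ≤ W := by
    rw [← hyr, hW]
    push_cast
    calc y ^ r = ∏ _i : Fin r, y := by simp
      _ ≤ _ := Finset.prod_le_prod (fun i _ => by positivity) fun i _ => he1 i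
  have hWM : (W : ℝ) ≤ M * X := by
    rw [← hyr, hW, hM]
    push_cast
    calc ∏ i, (p i : ℝ) ^ e i ≤ ∏ i, ((p i : ℝ) * y) :=
          Finset.prod_le_prod (fun i _ => by positivity) fun i _ => he2 i
      _ = _ := by simp [Finset.prod_mul_distrib]
  have hWcast : ((W - 1 : ℕ) : ℝ) = W - 1 := by push_cast [Nat.cast_sub hWpos]; ring
  refine ⟨e, ⌈L⌉₊, ?_, ?_⟩
  · have h1 : (n : ℝ) ≤ L ^ (W - 1) := by
      rw [← Real.log_le_log_iff hn0 (by positivity), Real.log_pow, hWcast]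
      have h2 : L ≤ X / 2 * l := by rw [hX]; apply le_of_eq; field_simp
      have h3 : X / 2 * l ≤ (W - 1) * l := by gcongr; linarith
      exact h2.trans h3
    have h2 : L ^ (W - 1) ≤ (⌈L⌉₊ : ℝ) ^ (W - 1) := by gcongr; exact Nat.le_ceil L
    exact_mod_cast h1.trans h2
  · set N := (W - 1) * ⌈L⌉₊ with hN
    set E := Real.exp (M * C₂ * (y * l)) with hE
    have hE1 : 1 ≤ E := Real.one_le_exp (by positivity)
    have hNL : (N : ℝ) ≤ C₁ * L ^ 2 := by
      have h1 : (⌈L⌉₊ : ℝ) ≤ 2 * L := by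
        have := Nat.ceil_lt_add_one (by linarith : 0 ≤ L); linarith
      have h2 : X ≤ 2 * L / δ := by rw [hX]; gcongr
      have h3 : ((W - 1 : ℕ) : ℝ) ≤ M * (2 * L / δ) := by
        rw [hWcast]
        have : M * X ≤ M * (2 * L / δ) := by gcongr
        linarith
      calc (N : ℝ) = ((W - 1 : ℕ) : ℝ) * ⌈L⌉₊ := by rw [hN]; push_cast; rfl
        _ ≤ M * (2 * L / δ) * (2 * L) := by gcongr
        _ = 4 * M / δ * L ^ 2 := by ring
        _ ≤ C₁ * L ^ 2 := by gcongr; rw [hC₁]; linarith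
    have hCL1 : 1 ≤ C₁ * L ^ 2 := one_le_mul_of_one_le_of_one_le hC₁1 (one_le_pow₀ hL1.le)
    have hlogC : Real.log (C₁ * L ^ 2) ≤ C₂ * l := by
      rw [Real.log_mul (by positivity) (by positivity), Real.log_pow, ← hl, hC₂, add_mul]
      have : Real.log C₁ ≤ Real.log C₁ / δ * l := by
        rw [div_mul_eq_mul_div, le_div_iff₀ hδ0]
        have := Real.log_nonneg hC₁1
        gcongr
      push_cast
      linarith
    have hchoose (i) : ((N.choose (p i ^ e i - 1) : ℕ) : ℝ) ≤ E := by
      calc ((N.choose (p i ^ e i - 1) : ℕ) : ℝ) ≤ (N : ℝ) ^ (p i ^ e i - 1) := by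
            exact_mod_cast Nat.choose_le_pow _ _
        _ ≤ (C₁ * L ^ 2) ^ (p i ^ e i - 1) := by gcongr
        _ = Real.exp (((p i ^ e i - 1 : ℕ) : ℝ) * Real.log (C₁ * L ^ 2)) := by
            rw [← Real.log_pow, Real.exp_log (by positivity)]
        _ ≤ E := by
            rw [hE]
            apply Real.exp_le_exp.2
            have h1 : ((p i ^ e i - 1 : ℕ) : ℝ) ≤ M * y := by
              have h1 : ((p i ^ e i - 1 : ℕ) : ℝ) ≤ (p i : ℝ) ^ e i := by
                exact_mod_cast Nat.sub_le _ _
              have h2 : p i * y ≤ M * y := by gcongr; exact hpM i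
              linarith [he2 i]
            have h0 := Real.log_nonneg hCL1
            calc _ ≤ M * y * (C₂ * l) := by gcongr
              _ = _ := by ring
    have hKE : K ≤ Real.exp (Real.log K / δ * (y * l)) := by
      have hlK := Real.log_nonneg hK1
      conv_lhs => rw [← Real.exp_log (by linarith : 0 < K)]
      apply Real.exp_le_exp.2
      have h1 : δ ≤ y * l := by nlinarith
      rw [div_mul_eq_mul_div, le_div_iff₀ hδ0]
      gcongr
    have hcomm : ((k * (∑ i, p i * (N.choose (p i ^ e i - 1) + 1) + A) : ℕ) : ℝ) ≤ K * E := by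
      have h1 : ∑ i, (p i : ℝ) * (((N.choose (p i ^ e i - 1) : ℕ) : ℝ) + 1)
          ≤ 2 * (∑ i, (p i : ℝ)) * E := by
        rw [mul_assoc, Finset.sum_mul, Finset.mul_sum]
        refine Finset.sum_le_sum fun i _ => ?_
        have : ((N.choose (p i ^ e i - 1) : ℕ) : ℝ) + 1 ≤ 2 * E := by linarith [hchoose i]
        calc _ ≤ (p i : ℝ) * (2 * E) := by gcongr
          _ = _ := by ring
      have h2 : (A : ℝ) ≤ A * E := le_mul_of_one_le_right (by positivity) hE1
      push_cast
      calc _ ≤ (k : ℝ) * (2 * (∑ i, (p i : ℝ)) * E + A * E) := by gcongr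
        _ = (K - 1) * E := by rw [hK]; ring
        _ ≤ K * E := by gcongr; linarith
    have hid : y * l = 2 ^ (1 / r : ℝ) * (L * (l / L) ^ (((r : ℝ) - 1) / r)) := by
      have hL0 : 0 < L := by linarith
      have hq : 0 < l / L := by positivity
      have hexp : ((r : ℝ) - 1) / r = 1 + -(1 / r) := by field_simp; ring
      have hXq : X = 2 * (l / L)⁻¹ := by rw [hX, inv_div]; ring
      rw [hy, hXq, Real.mul_rpow (by norm_num) (by positivity), hexp, Real.rpow_add hq,
        Real.rpow_one, Real.inv_rpow hq.le, Real.rpow_neg hq.le]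
      field_simp
    calc _ ≤ K * E := hcomm
      _ ≤ Real.exp (Real.log K / δ * (y * l)) * E := by gcongr
      _ = Real.exp (C₃ * (y * l)) := by rw [hE, ← Real.exp_add, hC₃]; congr 1; ring
      _ = _ := by
        rw [Real.rpow_def_of_pos hn0, hid, ← hL]
        congr 1
        ring

/-! ### Assembly -/

theorem mainTheorem4 (r : ℕ) (hr : 1 < r) :
    ∃ k : ℕ, k ≤ 3 * 2 ^ (r - 2) ∧
      ∃ c : ℝ, 0 < c ∧
        ∀ n : ℕ, 1 < n →
          ∃ P : PIRScheme k n,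
            3 ≤ n →
              (P.communication : ℝ) ≤
                (n : ℝ) ^ (c * (Real.log (Real.log (n : ℝ)) / Real.log (n : ℝ)) ^
                  (((r : ℝ) - 1) / (r : ℝ))) := by
  obtain ⟨s, rfl⟩ : ∃ s, r = s + 2 := ⟨r - 2, by omega⟩
  -- Indices from 67 on give primes above 67, so distinct from 3, 11 and the characteristic.
  let p : Fin (s + 2) → ℕ := Fin.cons 3 (Fin.cons 11 fun i => Nat.nth Nat.Prime (i + 67))
  have hbig (i : Fin s) : 67 < Nat.nth Nat.Prime (i + 67) := by
    have := Nat.add_two_le_nth_prime (i + 67)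
    omega
  have hp : ∀ i, (p i).Prime := Fin.forall_fin_succ.2 ⟨Nat.prime_three,
    Fin.forall_fin_succ.2 ⟨Nat.prime_eleven, fun i => Nat.prime_nth_prime _⟩⟩
  have h67 : ∀ i, p i ≠ 67 := Fin.forall_fin_succ.2 ⟨by simp [p],
    Fin.forall_fin_succ.2 ⟨by simp [p], fun i => (hbig i).ne'⟩⟩
  have hinj : Function.Injective p := by
    refine Fin.cons_injective_iff.2 ⟨?_, Fin.cons_injective_iff.2 ⟨?_, fun i j h => ?_⟩⟩
    · rintro ⟨i, hi⟩
      revert hi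
      refine Fin.cases ?_ (fun i => ?_) i
      · simp
      · have := hbig i
        simp only [Fin.cons_succ]
        omega
    · rintro ⟨i, hi⟩
      have := hbig i
      simp only at hi
      omega
    · have := Nat.nth_injective Nat.infinite_setOfPred_prime h
      exact Fin.ext (by omega)
  obtain ⟨F, _, _, _, γ, h0, h1, hne, hγ⟩ := exists_field_roots p hp h67 rfl rfl
  obtain ⟨d, l, hd⟩ := exists_decoding_coefficients γ h0 h1 hne
  obtain ⟨A, hA⟩ : ∃ A, Fintype.card F ≤ 2 ^ A := ⟨_, Nat.lt_two_pow_self.le⟩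
  have scheme {n : ℕ} (e : Fin (s + 2) → ℕ) (b : ℕ) (h : n ≤ b ^ (∏ i, p i ^ e i - 1)) :
      ∃ P : PIRScheme (3 * 2 ^ s) n, P.communication = 3 * 2 ^ s *
        (∑ i, p i * (((∏ i, p i ^ e i - 1) * b).choose (p i ^ e i - 1) + 1) + A) := by
    obtain ⟨S, hS, hcard⟩ := exists_sets h
    have hW : 1 ≤ ∏ i, p i ^ e i :=
      Finset.one_le_prod' fun i _ => Nat.one_le_pow _ _ (hp i).pos
    simpa using exists_pirScheme_of_sets p e hp hinj γ hγ d l hd S hS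
      (fun a => by rw [hcard, Nat.sub_add_cancel hW]) hA
  obtain ⟨c, hc, hpar⟩ := exists_prime_power_parameters (Nat.succ_pos _) p
    (fun i => (hp i).one_lt) (3 * 2 ^ s) A
  refine ⟨3 * 2 ^ s, by simp, c, hc, fun n hn => ?_⟩
  by_cases h3 : 3 ≤ n
  · obtain ⟨e, b, hb, hle⟩ := hpar n h3
    obtain ⟨P, hP⟩ := scheme e b hb
    exact ⟨P, fun _ => by rw [hP]; exact hle⟩
  -- For `n = 2` no bound is required, and the parameters for 3 suffice.
  · obtain ⟨e, b, hb, -⟩ := hpar 3 le_rfl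
    obtain ⟨P, -⟩ := scheme e b ((by omega : n ≤ 3).trans hb)
    exact ⟨P, fun h => absurd h h3⟩
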